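/- There exist absolute constants $c>0$ and $C>0$ such that for every prime $p$, all $n,r\in\mathbb{N}$, all $\varepsilon\in(0,1)$ and all $t\in\mathbb{N}$ with $t\le c\cdot\min\{\varepsilon^2,1/n^2\}\cdot p^n$, there is a randomized algorithm $T$ that makes at most $C\,(1/\varepsilon+\log_p t)$ adaptive queries and is an online $\varepsilon$-tester for homomorphism of functions $f:\mathbb{F}_p^n\to\mathbb{F}_p^r$ in the presence of every $t$-online budget-managing erasure adversary, and also in the presence of every $t$-online budget-managing corruption adversary. (For $t=0$, and also for $n=0$, where the hypothesis is read as $t=0$, the query bound is $C/\varepsilon$.) Moreover, in the presence of erasure adversaries, $T$ has 1-sided error: it accepts every homomorphism with probability $1$. Here the algorithm accesses $f$ through an oracle $f'$ that is initially equal to $f$. An adversary, who knows $f$, the algorithm and all queries made so far, but not the algorithm's internal randomness, may modify $f'$ after each answered query; a $t$-online budget-managing adversary may make at most $t\cdot i$ manipulations in total by the time the first $i$ queries have been answered, for every $i$. Each manipulation changes the value of $f'$ at one point: an erasure adversary replaces it by a special symbol $\perp$, a corruption adversary replaces it by an arbitrary element of $\mathbb{F}_p^r$. That $T$ is an online $\varepsilon$-tester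 for homomorphism in the presence of a class of adversaries means that, for every $f$ and every adversary in the class, $T$ accepts with probability at least $2/3$ if $f$ is a homomorphism, i.e. $f(x+y)=f(x)+f(y)$ for all $x,y$, and $T$ rejects with probability at least $2/3$ if $f$ is $\varepsilon$-far from homomorphisms, i.e. $\Pr_{x}[f(x)\ne h(x)]>\varepsilon$ for every homomorphism $h:\mathbb{F}_p^n\to\mathbb{F}_p^r$, where $x\in\mathbb{F}_p^n$ is uniform. -/

import Mathlib

open scoped ENNReal

/-! ### Properties of functions and distance -/

/-- The set of (graphs of) homomorphisms between two additive groups. -/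
def homProperty (G H : Type) [AddGroup G] [AddGroup H] : Set (G → H) :=
  Set.range fun h : G →+ H => (h : G → H)

/-- Relative Hamming distance `Pr_x [f x ≠ g x]`. -/
noncomputable def relDist {G H : Type} [Fintype G] [DecidableEq H] (f g : G → H) : ℝ :=
  (hammingDist f g : ℝ) / (Fintype.card G : ℝ)

/-- Relative Hamming distance from `f` to a (nonempty) property `P`. -/
noncomputable def distToProperty {G H : Type} [Fintype G] [DecidableEq H]
    (f : G → H) (P : Set (G → H)) : ℝ :=
  sInf ((fun g => relDist f g) '' P)

/-- `f` is `ε`-far from `P`. -/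
def IsFar {G H : Type} [Fintype G] [DecidableEq H] (ε : ℝ) (f : G → H) (P : Set (G → H)) : Prop :=
  ε < distToProperty f P

/-! ### Online adversaries -/

/-- A strategy of an online adversary.  `A l` is the current state of the oracle after the points in
`l` have been queried and answered, *most recent query first*; the value `none` is the erasure
symbol. The strategy sees all the queries made so far (and, being quantified after the tester and
the input function, may depend on both of them), but not the internal coins of the tester. -/
abbrev AdversaryStrategy (G H : Type) : Type := List G → G → Option H

/-- Total number of manipulations (entries changed, counted step by step) that the strategy makes
along the query history `l` (most recent query first). -/
def manipulationCount {G H : Type} [Fintype G] [DecidableEq H] (A : AdversaryStrategy G H) :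
    List G → ℕ
  | [] => 0
  | x :: l => manipulationCount A l + hammingDist (A (x :: l)) (A l)

/-- `t`-online budget-managing strategies on input `f`: the oracle is initially equal to `f`; each
answered query adds `t` manipulations to the budget, which can be spent at any later point. -/
def IsBudgetManaging {G H : Type} [Fintype G] [DecidableEq H] (t : ℕ) (f : G → H)
    (A : AdversaryStrategy G H) : Prop :=
  (∀ z, A [] z = some (f z)) ∧ ∀ l : List G, manipulationCount A l ≤ t * l.length

/-- The `t`-online erasure budget-managing strategies: every change replaces a value by `none`. -/
def erasureAdversaries {G H : Type} [Fintype G] [DecidableEq H] (t : ℕ) (f : G → H) :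
    Set (AdversaryStrategy G H) :=
  {A | IsBudgetManaging t f A ∧ ∀ l x z, A (x :: l) z ≠ A l z → A (x :: l) z = none}

/-- The `t`-online corruption budget-managing strategies: every change replaces a value by an
arbitrary element of the codomain. -/
def corruptionAdversaries {G H : Type} [Fintype G] [DecidableEq H] (t : ℕ) (f : G → H) :
    Set (AdversaryStrategy G H) :=
  {A | IsBudgetManaging t f A ∧ ∀ l x z, A (x :: l) z ≠ A l z → ∃ h : H, A (x :: l) z = some h}

/-! ### Query algorithms and testers -/

/-- Deterministic adaptive query algorithms (decision trees): either output a verdict (`true` for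
accept, `false` for reject), or query a point and continue depending on the answer. -/
inductive QueryAlg (G H : Type) : Type
  | output (verdict : Bool) : QueryAlg G H
  | query (x : G) (next : Option H → QueryAlg G H) : QueryAlg G H

/-- Verdict of a query algorithm run against a strategy `A`, starting from the query history `l`
(most recent query first). -/
def QueryAlg.run {G H : Type} (A : AdversaryStrategy G H) : List G → QueryAlg G H → Bool
  | _, .output b => b
  | l, .query x next => QueryAlg.run A (x :: l) (next (A l x))

/-- Whatever the answers are, the algorithm makes at most `q` queries. -/
def QueryAlg.QueriesAtMost {G H : Type} : ℕ → QueryAlg G H → Prop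
  | _, .output _ => True
  | 0, .query _ _ => False
  | q + 1, .query _ next => ∀ a, QueryAlg.QueriesAtMost q (next a)

/-- A randomized query algorithm: the internal coins, tossed in advance and hidden from the
adversary, select a deterministic query algorithm. -/
abbrev Tester (G H : Type) : Type := PMF (QueryAlg G H)

/-- Probability, over the internal randomness of the tester, that it outputs `verdict`. -/
noncomputable def Tester.prob {G H : Type} (T : Tester G H) (A : AdversaryStrategy G H)
    (verdict : Bool) : ℝ≥0∞ :=
  (T.map fun D => D.run A []) verdict

/-- The tester makes at most `q` queries, for all internal coins and all answers. -/
def Tester.QueriesAtMost {G H : Type} (T : Tester G H) (q : ℕ) : Prop :=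
  ∀ D ∈ T.support, D.QueriesAtMost q

/-- `T` is an online `ε`-tester for `P` in the presence of all strategies of a specified type. -/
def IsOnlineTester {G H : Type} [Fintype G] [DecidableEq H] (ε : ℝ) (P : Set (G → H))
    (adversaries : (G → H) → Set (AdversaryStrategy G H)) (T : Tester G H) : Prop :=
  ∀ f : G → H, ∀ A ∈ adversaries f,
    (f ∈ P → 2 / 3 ≤ T.prob A true) ∧ (IsFar ε f P → 2 / 3 ≤ T.prob A false)

/-- `T` has 1-sided error: whatever its coins, it accepts every function in `P`. -/
def HasOneSidedError {G H : Type} (P : Set (G → H))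
    (adversaries : (G → H) → Set (AdversaryStrategy G H)) (T : Tester G H) : Prop :=
  ∀ f ∈ P, ∀ A ∈ adversaries f, ∀ D ∈ T.support, D.run A [] = true

/-! ### The Blum–Luby–Rubinfeld test -/

/-! The Blum–Luby–Rubinfeld test queries `x`, `y`, `x + y`, so after seeing `x` and `y` the
adversary can spoil `x + y`. The remedy is to hide the test in a pool with many combinations. The
tester queries the components of `k + 1` random pairs `w i`. A check then draws random coefficients
`s`, which turn the pool into one pair `affComb s w`, and queries only its first component, its
second component or their sum. The answer is compared with the same combination of the known values
of `f`. The adversary faces `p ^ k` possible coefficient vectors.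

Soundness. For distinct `s` the pairs `affComb s w` are uniform and pairwise independent. By
Chebyshev (`card_filter_affComb_hits_le`), most pools contain nearly the right fraction of pairs
violating additivity, and far functions have many such pairs (`violations_ge_of_isFar`). On a
violating pair at least one of the three kinds of check fails (`exists_checkFails`), so `m` of order
`1 / ε` independent checks suffice (`card_no_checkFails_le`). A failed check excludes every linear
map.

Manipulations. A pool point is uniform given the history. A check point falls on a given point for
at most as many `s` as there are linear relations in the pool, and the mean number of relations is
at most `1 + p ^ k / p ^ n`. A union bound over the `q` queries bounds the probability of seeing a
manipulation by `3 * t * q ^ 2 * (1 / p ^ n + 1 / p ^ k)`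
(`IsBudgetManaging.card_hitsManipulated_le`). Off this event the answers are those of `f`, whatever
the type of adversary. Erasures never contradict a homomorphism, hence the 1-sided error. -/

section BLR

variable {G H : Type} [AddCommGroup G] [Fintype G] [AddCommGroup H]

open Classical in
/-- The pairs on which additivity of `f` fails. -/
noncomputable def additivityViolations (f : G → H) : Finset (G × G) :=
  Finset.univ.filter fun z => f z.1 + f z.2 ≠ f (z.1 + z.2)

-- Both `f (x + y) + f y'` and `f (x + y') + f y` should equal `f (x + y + y')`. The two differences
-- can disagree only if one of these two additivity relations is violated.
open Classical in
lemma card_filter_sub_ne_le (f : G → H) (x : G) :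
    (Finset.univ.filter fun z : G × G => f (x + z.1) - f z.1 ≠ f (x + z.2) - f z.2).card ≤
      2 * (additivityViolations f).card := by
  have h1 : (Finset.univ.filter fun z : G × G => (x + z.1, z.2) ∈ additivityViolations f).card ≤
      (additivityViolations f).card := by
    refine Finset.card_le_card_of_injOn (fun z => (x + z.1, z.2)) (by intro z; simp) ?_
    rintro ⟨a, b⟩ - ⟨c, d⟩ -
    simp
  have h2 : (Finset.univ.filter fun z : G × G => (x + z.2, z.1) ∈ additivityViolations f).card ≤
      (additivityViolations f).card := by
    refine Finset.card_le_card_of_injOn (fun z => (x + z.2, z.1)) (by intro z; simp) ?_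
    rintro ⟨a, b⟩ - ⟨c, d⟩ -
    simp +contextual
  rw [two_mul]
  refine le_trans (Finset.card_le_card (t := (Finset.univ.filter fun z : G × G =>
    (x + z.1, z.2) ∈ additivityViolations f) ∪ (Finset.univ.filter fun z : G × G =>
    (x + z.2, z.1) ∈ additivityViolations f)) ?_)
    ((Finset.card_union_le _ _).trans (add_le_add h1 h2))
  intro z hz
  simp only [additivityViolations, Finset.mem_union, Finset.mem_filter, Finset.mem_univ,
    true_and] at hz ⊢
  by_contra hcon
  push Not at hcon
  apply hz
  have h3 : x + z.1 + z.2 = x + z.2 + z.1 := by abel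
  rw [sub_eq_sub_iff_add_eq_add, hcon.1, hcon.2, h3]

-- A collision bound yields a popular value: averaging over `y'`, some difference `f (x + y') - f
-- y'` is itself a good choice of `h`.
open Classical in
lemma exists_majority_difference (f : G → H) (x : G) :
    ∃ h : H, (Finset.univ.filter fun y => f (x + y) - f y ≠ h).card * Fintype.card G ≤
      2 * (additivityViolations f).card := by
  by_contra! hcon
  have h1 : ∑ y' : G, (Finset.univ.filter fun y => f (x + y) - f y ≠ f (x + y') - f y').card =
      (Finset.univ.filter fun z : G × G => f (x + z.1) - f z.1 ≠ f (x + z.2) - f z.2).card := by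
    simp only [Finset.card_filter]
    rw [Fintype.sum_prod_type_right]
  have h2 := card_filter_sub_ne_le f x
  have h3 : ∑ _y' : G, 2 * (additivityViolations f).card <
      ∑ y' : G, (Finset.univ.filter fun y => f (x + y) - f y ≠ f (x + y') - f y').card *
        Fintype.card G :=
    Finset.sum_lt_sum_of_nonempty Finset.univ_nonempty fun y' _ => hcon _
  rw [Finset.sum_const, ← Finset.sum_mul, h1, Finset.card_univ, smul_eq_mul, mul_comm] at h3
  exact absurd (lt_of_mul_lt_mul_right h3 (Nat.zero_le _)) (not_lt.2 h2)

open Classical in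
/-- If additivity of `f` fails on less than a sixth of all pairs, then `f` is close to a
homomorphism. -/
theorem exists_addMonoidHom_of_violations_lt (f : G → H)
    (hf : 6 * (additivityViolations f).card < Fintype.card G ^ 2) :
    ∃ h : G →+ H, 2 * (Finset.univ.filter fun x => f x ≠ h x).card * Fintype.card G ≤
      3 * (additivityViolations f).card := by
  choose g hg using exists_majority_difference f
  set N := Fintype.card G
  set V := (additivityViolations f).card
  have hN : 0 < N := Fintype.card_pos
  have hadd : ∀ x x', g (x + x') = g x + g x' := by
    intro x x'
    have hsh : (Finset.univ.filter fun y => f (x + (x' + y)) - f (x' + y) ≠ g x).card =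
        (Finset.univ.filter fun y => f (x + y) - f y ≠ g x).card := by
      refine Finset.card_bijective (fun y => x' + y) (AddGroup.addLeft_bijective x') ?_
      simp
    set A := Finset.univ.filter fun y => f (x + (x' + y)) - f (x' + y) ≠ g x
    set B := Finset.univ.filter fun y => f (x' + y) - f y ≠ g x'
    set C := Finset.univ.filter fun y => f (x + x' + y) - f y ≠ g (x + x')
    -- Each exceptional set has at most `2 * V / N < N / 3` elements, so some `y` avoids all three.
    have hcard : (A ∪ B ∪ C).card < N := by
      have h1 := (Finset.card_union_le (A ∪ B) C)
      have h2 := (Finset.card_union_le A B)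
      have hA : A.card * N ≤ 2 * V := hsh ▸ hg x
      have hB : B.card * N ≤ 2 * V := hg x'
      have hC : C.card * N ≤ 2 * V := hg (x + x')
      refine lt_of_mul_lt_mul_right (a := N) ?_ (Nat.zero_le _)
      nlinarith
    obtain ⟨y, hy⟩ : ∃ y, y ∉ A ∪ B ∪ C := by
      by_contra! hcon
      rw [Finset.eq_univ_iff_forall.2 hcon, Finset.card_univ] at hcard
      exact lt_irrefl _ hcard
    simp only [A, B, C, Finset.mem_union, Finset.mem_filter, Finset.mem_univ, true_and, not_or,
      not_not] at hy
    obtain ⟨⟨h1, h2⟩, h3⟩ := hy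
    rw [← h1, ← h2, ← h3, add_assoc]
    abel
  refine ⟨AddMonoidHom.mk' g hadd, ?_⟩
  simp only [AddMonoidHom.mk'_apply]
  set S := Finset.univ.filter fun x => f x ≠ g x
  have hV : ∑ x ∈ S, (Finset.univ.filter fun y => f x + f y ≠ f (x + y)).card ≤ V := by
    calc _ ≤ ∑ x, (Finset.univ.filter fun y => f x + f y ≠ f (x + y)).card :=
          Finset.sum_le_univ_sum_of_nonneg fun _ => Nat.zero_le _
      _ = V := by
          simp only [V, additivityViolations, Finset.card_filter]
          rw [Fintype.sum_prod_type]
  -- Where `f x ≠ g x`, any `y` voting for `g x` gives a violation, and more than two thirds of all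
  -- `y` do so.
  have hx : ∀ x ∈ S, 2 * N ≤ 3 * (Finset.univ.filter fun y => f x + f y ≠ f (x + y)).card := by
    intro x hx
    have hx' : f x ≠ g x := by simpa [S] using hx
    have hcov : N ≤ (Finset.univ.filter fun y => f x + f y ≠ f (x + y)).card +
        (Finset.univ.filter fun y => f (x + y) - f y ≠ g x).card := by
      refine le_trans (Finset.card_univ (α := G)).ge (le_trans (Finset.card_le_card ?_) (Finset.card_union_le _ _))
      intro y _
      simp only [Finset.mem_union, Finset.mem_filter, Finset.mem_univ, true_and]
      by_contra! hcon
      exact hx' (by rw [← hcon.2, ← hcon.1]; abel)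
    have h1 := hg x
    refine le_of_mul_le_mul_right (a := N) ?_ hN
    nlinarith
  have hsum := Finset.sum_le_sum hx
  rw [Finset.sum_const, smul_eq_mul, ← Finset.mul_sum] at hsum
  calc 2 * S.card * N = S.card * (2 * N) := by ring
    _ ≤ _ := hsum
    _ ≤ 3 * V := Nat.mul_le_mul_left _ hV

/-- A function that is `ε`-far from homomorphisms violates additivity on at least an `ε / 6`
fraction of all pairs. -/
theorem violations_ge_of_isFar [DecidableEq H] {ε : ℝ} (hε1 : ε < 1) {f : G → H}
    (hf : IsFar ε f (homProperty G H)) :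
    ε / 6 * (Fintype.card G : ℝ) ^ 2 ≤ (additivityViolations f).card := by
  classical
  by_cases hV : 6 * (additivityViolations f).card < Fintype.card G ^ 2
  · obtain ⟨h, hh⟩ := exists_addMonoidHom_of_violations_lt f hV
    have hdist : ε < relDist f h := by
      refine lt_of_lt_of_le hf (csInf_le ⟨0, ?_⟩ ⟨h, ⟨h, rfl⟩, rfl⟩)
      rintro _ ⟨g, -, rfl⟩
      simp only [relDist]
      positivity
    have hN : (0 : ℝ) < Fintype.card G := by exact_mod_cast Fintype.card_pos
    rw [relDist, lt_div_iff₀ hN] at hdist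
    have hh' : (2 : ℝ) * hammingDist f h * Fintype.card G ≤ 3 * (additivityViolations f).card := by
      norm_cast
      convert hh
      unfold hammingDist
      congr!
    have := mul_lt_mul_of_pos_right hdist hN
    nlinarith [Nat.cast_nonneg (α := ℝ) (additivityViolations f).card]
  -- The violation density is at least `1 / 6`, which exceeds `ε / 6`. This case dictates the
  -- constant; the other one gives `2 * ε / 3`.
  · have hV' : (Fintype.card G : ℝ) ^ 2 ≤ 6 * (additivityViolations f).card := by
      exact_mod_cast not_lt.1 hV
    nlinarith [sq_nonneg (Fintype.card G : ℝ)]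

end BLR

/-! ### Averaging over families of bijections -/

section Averaging

variable {Ω α : Type} [Fintype Ω] [Fintype α]

/-- Resampling part of the coins acts by permutations of the coin space, so it preserves the uniform
measure. This double count plays the role of conditioning on the remaining coins. -/
lemma sum_card_filter_perm (e : α → Equiv.Perm Ω) (P : Ω → Prop) [DecidablePred P] :
    ∑ ω, (Finset.univ.filter fun z => P (e z ω)).card =
      Fintype.card α * (Finset.univ.filter P).card := by
  simp only [Finset.card_filter]
  rw [Finset.sum_comm]
  have h : ∀ z, ∑ ω, (if P (e z ω) then 1 else 0) = ∑ ω, if P ω then 1 else 0 := fun z =>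
    Equiv.sum_comp (e z) fun ω => if P ω then 1 else 0
  simp [h]

lemma card_mul_card_filter_le (e : α → Equiv.Perm Ω) (P : Ω → Prop) [DecidablePred P] (C : Ω → ℕ)
    (h : ∀ ω, (Finset.univ.filter fun z => P (e z ω)).card ≤ C ω) :
    Fintype.card α * (Finset.univ.filter P).card ≤ ∑ ω, C ω := by
  rw [← sum_card_filter_perm e P]
  exact Finset.sum_le_sum fun ω _ => h ω

end Averaging

/-! ### Random affine combinations of random points -/

section AffineCombination

variable {F W : Type} [Field F] [AddCommGroup W] [Module F W] {k : ℕ}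

/-- The combination `w 0 + ∑ i, s i • w (i + 1)`. -/
def affComb (s : Fin k → F) (w : Fin (k + 1) → W) : W := w 0 + ∑ i, s i • w i.succ

lemma affComb_add (s : Fin k → F) (w w' : Fin (k + 1) → W) :
    affComb s (w + w') = affComb s w + affComb s w' := by
  simp only [affComb, Pi.add_apply, smul_add, Finset.sum_add_distrib]
  abel

lemma affComb_single_zero (s : Fin k → F) (y : W) : affComb s (Pi.single 0 y) = y := by
  simp [affComb, Fin.succ_ne_zero]

lemma affComb_single_succ (s : Fin k → F) (i : Fin k) (z : W) :
    affComb s (Pi.single i.succ z) = s i • z := by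
  have h : ∀ j : Fin k, s j • (Pi.single i.succ z : Fin (k + 1) → W) j.succ =
      if j = i then s i • z else 0 := by
    intro j
    by_cases hj : j = i
    · subst hj; simp
    · simp [hj]
  simp [affComb, h, (Fin.succ_ne_zero i).symm]

lemma map_affComb {W' : Type} [AddCommGroup W'] [Module F W'] (φ : W →ₗ[F] W') (s : Fin k → F)
    (w : Fin (k + 1) → W) : φ (affComb s w) = affComb s fun i => φ (w i) := by
  simp [affComb]

variable [Fintype W]

-- Translating `w 0` makes the combination uniform on `W`.
open Classical in
lemma card_filter_affComb_mem (V : Finset W) (s : Fin k → F) :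
    Fintype.card W * (Finset.univ.filter fun w : Fin (k + 1) → W => affComb s w ∈ V).card =
      V.card * Fintype.card (Fin (k + 1) → W) := by
  rw [← sum_card_filter_perm (fun y : W => Equiv.addRight (Pi.single 0 y))]
  have h : ∀ w : Fin (k + 1) → W, (Finset.univ.filter fun y : W =>
      affComb s (Equiv.addRight (Pi.single 0 y) w) ∈ V).card = V.card := by
    intro w
    refine Finset.card_bijective (fun y => affComb s w + y) (AddGroup.addLeft_bijective _) ?_
    simp [affComb_add, affComb_single_zero]
  simp only [h, Finset.sum_const, Finset.card_univ, smul_eq_mul, mul_comm]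

-- Pairwise independence: choose `i` with `s i ≠ s' i`. Translating `w 0` by `a` and `w i.succ` by
-- `b` moves the two combinations by `a + s i • b` and `a + s' i • b`, which together determine `(a,
-- b)`.
open Classical in
lemma card_filter_affComb_mem_mem_le (V : Finset W) {s s' : Fin k → F} (hs : s ≠ s') :
    Fintype.card W ^ 2 * (Finset.univ.filter fun w : Fin (k + 1) → W =>
      affComb s w ∈ V ∧ affComb s' w ∈ V).card ≤
      V.card ^ 2 * Fintype.card (Fin (k + 1) → W) := by
  obtain ⟨i, hi⟩ := Function.ne_iff.1 hs
  have key := card_mul_card_filter_le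
    (fun y : W × W => Equiv.addRight (Pi.single 0 y.1 + Pi.single i.succ y.2))
    (fun w : Fin (k + 1) → W => affComb s w ∈ V ∧ affComb s' w ∈ V) (fun _ => V.card ^ 2) ?_
  · simpa [sq, mul_comm] using key
  · intro w
    rw [sq, ← Finset.card_product]
    refine Finset.card_le_card_of_injOn
      (fun y => (affComb s w + (y.1 + s i • y.2), affComb s' w + (y.1 + s' i • y.2))) ?_ ?_
    · intro y
      simp +contextual [affComb_add, affComb_single_zero, affComb_single_succ, add_assoc]
    · rintro ⟨a, b⟩ - ⟨c, d⟩ - h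
      simp only [Prod.mk.injEq, add_right_inj] at h
      have h1 : (s i - s' i) • (b - d) = 0 := by
        have h2 : s i • b - s i • d = c - a := by
          rw [sub_eq_sub_iff_add_eq_add, add_comm, h.1, add_comm]
        have h3 : s' i • b - s' i • d = c - a := by
          rw [sub_eq_sub_iff_add_eq_add, add_comm, h.2, add_comm]
        rw [sub_smul, smul_sub, smul_sub, h2, h3, sub_self]
      have h4 : b = d := by
        rcases smul_eq_zero.1 h1 with h5 | h5
        · exact absurd (sub_eq_zero.1 h5) hi
        · exact sub_eq_zero.1 h5
      subst h4
      simpa using h.1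

variable [Fintype F]

open Classical in
/-- Chebyshev's inequality: for most `w`, the affine combinations of `w` hit `V` about as often as
independent uniform points do. -/
theorem card_filter_affComb_hits_le (V : Finset W) {ρ : ℝ}
    (hρ : (V.card : ℝ) = ρ * Fintype.card W) :
    ((Finset.univ.filter fun w : Fin (k + 1) → W =>
        ((Finset.univ.filter fun s : Fin k → F => affComb s w ∈ V).card : ℝ) ≤
          ρ * Fintype.card (Fin k → F) / 2).card : ℝ) * (ρ * Fintype.card (Fin k → F)) ≤
      4 * Fintype.card (Fin (k + 1) → W) := by
  set N : ℝ := (Fintype.card (Fin k → F) : ℝ) with hN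
  set M : ℝ := (Fintype.card (Fin (k + 1) → W) : ℝ) with hM
  have hW : (0 : ℝ) < Fintype.card W := by exact_mod_cast Fintype.card_pos
  have hNpos : 0 < N := by rw [hN]; exact_mod_cast Fintype.card_pos
  have hM0 : 0 ≤ M := by positivity
  have hρ0 : 0 ≤ ρ := by
    by_contra! hcon
    nlinarith [Nat.cast_nonneg (α := ℝ) V.card]
  set I : (Fin k → F) → (Fin (k + 1) → W) → ℝ := fun s w => if affComb s w ∈ V then 1 else 0
    with hI
  set X : (Fin (k + 1) → W) → ℝ := fun w => ∑ s, I s w with hX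
  have hXcard : ∀ w, ((Finset.univ.filter fun s : Fin k → F => affComb s w ∈ V).card : ℝ) = X w := by
    intro w
    simp [hX, hI, Finset.sum_boole]
  have h1 : ∀ s, ∑ w, I s w = ρ * M := by
    intro s
    have h := card_filter_affComb_mem V s
    have h' : (Fintype.card W : ℝ) * ∑ w, I s w = V.card * M := by
      simp only [hI, Finset.sum_boole, hM]
      exact_mod_cast h
    rw [hρ] at h'
    refine mul_left_cancel₀ hW.ne' ?_
    rw [h']; ring
  -- Only the diagonal contributes to the variance, which is therefore at most the mean `ρ * N`.
  have h2 : ∀ s s', ∑ w, I s w * I s' w ≤ ρ ^ 2 * M + if s = s' then ρ * M else 0 := by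
    intro s s'
    split_ifs with hs
    · subst hs
      have : ∀ w, I s w * I s w = I s w := by intro w; simp [hI]
      simp only [this, h1]
      have : 0 ≤ ρ ^ 2 * M := by positivity
      linarith
    · have h := card_filter_affComb_mem_mem_le V hs
      have h' : (Fintype.card W : ℝ) ^ 2 * ∑ w, I s w * I s' w ≤ V.card ^ 2 * M := by
        have : ∀ w, I s w * I s' w = if affComb s w ∈ V ∧ affComb s' w ∈ V then 1 else 0 := by
          intro w
          simp only [hI]
          split_ifs <;> simp_all
        simp only [this, Finset.sum_boole, hM]
        exact_mod_cast h
      rw [hρ] at h'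
      refine le_of_mul_le_mul_left (a := (Fintype.card W : ℝ) ^ 2) ?_ (by positivity)
      calc _ ≤ _ := h'
        _ = _ := by ring
  have hsum1 : ∑ w, X w = N * (ρ * M) := by
    simp only [hX]
    rw [Finset.sum_comm]
    simp [h1, hN]
  have hsum2 : ∑ w, X w ^ 2 ≤ N ^ 2 * (ρ ^ 2 * M) + N * (ρ * M) := by
    calc ∑ w, X w ^ 2 = ∑ s, ∑ s', ∑ w, I s w * I s' w := by
          simp only [hX, sq, Finset.sum_mul_sum]
          rw [Finset.sum_comm]
          refine Finset.sum_congr rfl fun s _ => ?_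
          rw [Finset.sum_comm]
      _ ≤ ∑ s : Fin k → F, ∑ s' : Fin k → F, (ρ ^ 2 * M + if s = s' then ρ * M else 0) :=
          Finset.sum_le_sum fun s _ => Finset.sum_le_sum fun s' _ => h2 s s'
      _ = _ := by
          simp only [Finset.sum_add_distrib, Finset.sum_const, Finset.card_univ,
            Finset.sum_ite_eq, Finset.mem_univ, if_true, nsmul_eq_mul, ← hN]
          ring
  have hvar : ∑ w, (X w - ρ * N) ^ 2 ≤ N * (ρ * M) := by
    have : ∑ w, (X w - ρ * N) ^ 2 = ∑ w, X w ^ 2 - 2 * (ρ * N) * ∑ w, X w + M * (ρ * N) ^ 2 := by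
      rw [Finset.mul_sum, ← Finset.sum_sub_distrib]
      have : M * (ρ * N) ^ 2 = ∑ _w : Fin (k + 1) → W, (ρ * N) ^ 2 := by
        rw [Finset.sum_const, Finset.card_univ, nsmul_eq_mul]
      rw [this, ← Finset.sum_add_distrib]
      exact Finset.sum_congr rfl fun w _ => by ring
    rw [this, hsum1]
    linarith [hsum2, show 2 * (ρ * N) * (N * (ρ * M)) = 2 * (N ^ 2 * (ρ ^ 2 * M)) by ring,
      show M * (ρ * N) ^ 2 = N ^ 2 * (ρ ^ 2 * M) by ring]
  simp only [hXcard]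
  set S := Finset.univ.filter fun w => X w ≤ ρ * N / 2
  have hS : (S.card : ℝ) * (ρ * N / 2) ^ 2 ≤ N * (ρ * M) := by
    calc (S.card : ℝ) * (ρ * N / 2) ^ 2 = ∑ _w ∈ S, (ρ * N / 2) ^ 2 := by simp
      _ ≤ ∑ w ∈ S, (X w - ρ * N) ^ 2 := by
          refine Finset.sum_le_sum fun w hw => ?_
          have hw' : X w ≤ ρ * N / 2 := (Finset.mem_filter.1 hw).2
          have h0 : 0 ≤ ρ * N := by positivity
          nlinarith
      _ ≤ ∑ w, (X w - ρ * N) ^ 2 := Finset.sum_le_univ_sum_of_nonneg fun _ => sq_nonneg _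
      _ ≤ _ := hvar
  rcases hρ0.eq_or_lt with h0 | h0
  · rw [← h0]
    simpa using hM0
  · refine le_of_mul_le_mul_right (a := ρ * N) ?_ (by positivity)
    nlinarith

end AffineCombination

/-! ### Nonadaptive query algorithms against online adversaries -/

section Nonadaptive

variable {G H : Type}

/-- Query the given points in order, then decide on the list of the answers. -/
def QueryAlg.queryAll : List G → (List (Option H) → Bool) → QueryAlg G H
  | [], v => .output (v [])
  | x :: qs, v => .query x fun a => QueryAlg.queryAll qs fun as => v (a :: as)

/-- The answers to a list of queries, asked after the query history `l`. -/
def AdversaryStrategy.answers (A : AdversaryStrategy G H) : List G → List G → List (Option H)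
  | _, [] => []
  | l, x :: qs => A l x :: AdversaryStrategy.answers A (x :: l) qs

/-- One of the listed queries, asked after the query history `l`, hits a manipulated point. -/
def AdversaryStrategy.HitsManipulated (A : AdversaryStrategy G H) (f : G → H) :
    List G → List G → Prop
  | _, [] => False
  | l, x :: qs => A l x ≠ some (f x) ∨ AdversaryStrategy.HitsManipulated A f (x :: l) qs

lemma QueryAlg.run_queryAll (A : AdversaryStrategy G H) (qs : List G) :
    ∀ (l : List G) (v : List (Option H) → Bool),
      QueryAlg.run A l (QueryAlg.queryAll qs v) = v (A.answers l qs) := by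
  induction qs with
  | nil => intro l v; rfl
  | cons x qs ih =>
    intro l v
    simp only [QueryAlg.queryAll, QueryAlg.run, AdversaryStrategy.answers, ih]

lemma QueryAlg.queriesAtMost_queryAll (qs : List G) :
    ∀ v : List (Option H) → Bool, (QueryAlg.queryAll qs v).QueriesAtMost qs.length := by
  induction qs with
  | nil => intro v; simp [QueryAlg.queryAll, QueryAlg.QueriesAtMost]
  | cons x qs ih => intro v a; exact ih _

lemma AdversaryStrategy.answers_eq_map {A : AdversaryStrategy G H} {f : G → H} (qs : List G) :
    ∀ l, ¬ A.HitsManipulated f l qs → A.answers l qs = qs.map fun x => some (f x) := by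
  induction qs with
  | nil => intro l _; rfl
  | cons x qs ih =>
    intro l h
    simp only [AdversaryStrategy.HitsManipulated, not_or, not_not] at h
    simp only [AdversaryStrategy.answers, List.map_cons, h.1, ih _ h.2]

lemma AdversaryStrategy.eq_none_or_of_mem_zip_answers {A : AdversaryStrategy G H} {f : G → H}
    (hA : ∀ l x, A l x = none ∨ A l x = some (f x)) (qs : List G) :
    ∀ l, ∀ z ∈ qs.zip (A.answers l qs), z.2 = none ∨ z.2 = some (f z.1) := by
  induction qs with
  | nil => intro l z hz; simp at hz
  | cons x qs ih =>
    intro l z hz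
    simp only [AdversaryStrategy.answers, List.zip_cons_cons, List.mem_cons] at hz
    rcases hz with rfl | hz
    · exact hA l x
    · exact ih _ z hz

lemma AdversaryStrategy.hitsManipulated_append (A : AdversaryStrategy G H) (f : G → H)
    (qs qs' : List G) : ∀ l, A.HitsManipulated f l (qs ++ qs') ↔
      A.HitsManipulated f l qs ∨ A.HitsManipulated f (qs.reverse ++ l) qs' := by
  induction qs with
  | nil => intro l; simp [AdversaryStrategy.HitsManipulated]
  | cons x qs ih =>
    intro l
    simp [AdversaryStrategy.HitsManipulated, ih, or_assoc]

lemma AdversaryStrategy.hitsManipulated_ofFn (A : AdversaryStrategy G H) (f : G → H) {n : ℕ} :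
    ∀ (g : Fin n → G) (l : List G), A.HitsManipulated f l (List.ofFn g) ↔
      ∃ i : Fin n, A (((List.ofFn g).take i).reverse ++ l) (g i) ≠ some (f (g i)) := by
  induction n with
  | zero => intro g l; simp [AdversaryStrategy.HitsManipulated]
  | succ n ih =>
    intro g l
    simp only [List.ofFn_succ, AdversaryStrategy.HitsManipulated, ih, Fin.exists_fin_succ]
    simp

lemma List.take_ofFn_congr {n : ℕ} {g g' : Fin n → G} (i : Fin n) (h : ∀ j < i, g j = g' j) :
    (List.ofFn g).take i = (List.ofFn g').take i := by
  refine List.ext_getElem (by simp) fun j h1 h2 => ?_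
  simp only [List.getElem_take, List.getElem_ofFn]
  refine h _ ?_
  simp only [List.length_take] at h1
  exact Fin.lt_def.2 (lt_of_lt_of_le h1 (min_le_left _ _))

variable [Fintype G] [DecidableEq H]

lemma IsBudgetManaging.hammingDist_le {t : ℕ} {f : G → H} {A : AdversaryStrategy G H}
    (hA : IsBudgetManaging t f A) (l : List G) :
    hammingDist (A l) (fun x => some (f x)) ≤ t * l.length := by
  refine le_trans ?_ (hA.2 l)
  induction l with
  | nil =>
    have : A [] = fun x => some (f x) := funext hA.1
    simp [this]
  | cons x l ih =>
    have := hammingDist_triangle (A (x :: l)) (A l) (fun x => some (f x))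
    simp only [manipulationCount]
    lia

lemma eq_none_or_of_mem_erasureAdversaries {t : ℕ} {f : G → H} {A : AdversaryStrategy G H}
    (hA : A ∈ erasureAdversaries t f) (l : List G) (x : G) : A l x = none ∨ A l x = some (f x) := by
  induction l with
  | nil => exact Or.inr (hA.1.1 x)
  | cons y l ih =>
    by_cases h : A (y :: l) x = A l x
    · rwa [h]
    · exact Or.inl (hA.2 l y x h)

open Classical in
/-- If a query is spread out by resampling coins on which the query history does not depend, then
it is unlikely to hit a manipulated point. -/
lemma IsBudgetManaging.card_hits_le {t q : ℕ} {f : G → H} {A : AdversaryStrategy G H}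
    (hA : IsBudgetManaging t f A) {Ω α : Type} [Fintype Ω] [Fintype α] (e : α → Equiv.Perm Ω)
    (hist : Ω → List G) (Q : Ω → G) (K : Ω → ℕ) (hlen : ∀ ω, (hist ω).length ≤ q)
    (hhist : ∀ z ω, hist (e z ω) = hist ω)
    (hK : ∀ ω y, (Finset.univ.filter fun z => Q (e z ω) = y).card ≤ K ω) :
    Fintype.card α * (Finset.univ.filter fun ω => A (hist ω) (Q ω) ≠ some (f (Q ω))).card ≤
      t * q * ∑ ω, K ω := by
  rw [Finset.mul_sum]
  refine card_mul_card_filter_le e _ _ fun ω => ?_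
  simp only [hhist]
  -- The manipulated set depends on the history alone, so it stays fixed while the query is
  -- resampled.
  set M := Finset.univ.filter fun y => A (hist ω) y ≠ some (f y) with hM
  have hMcard : M.card ≤ t * q := by
    refine le_trans (le_of_eq ?_)
      ((hA.hammingDist_le (hist ω)).trans (Nat.mul_le_mul_left t (hlen ω)))
    rw [hM]
    unfold hammingDist
    congr!
  refine le_trans (Finset.card_le_mul_card_image_of_maps_to (f := fun z => Q (e z ω)) (t := M) ?_
    (K ω) fun y _ => ?_) ?_
  · intro z hz
    simpa [hM] using hz
  · exact le_trans (Finset.card_le_card (Finset.filter_subset_filter _ (Finset.subset_univ _)))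
      (hK ω y)
  · rw [mul_comm]
    exact Nat.mul_le_mul_right _ hMcard

end Nonadaptive

/-! ### The tester -/

section HomTester

variable {F G H : Type} [Field F] [AddCommGroup G] [Module F G] [AddCommGroup H] [Module F H]
  {k m : ℕ}

/-- The coins of the tester: random pairs of points, and for every check its kind and the
coefficients of an affine combination. -/
abbrev HomTesterCoins (F G : Type) (k m : ℕ) : Type :=
  (Fin (k + 1) → G × G) × (Fin m → Fin 3 × (Fin k → F))

/-- First component, second component, and their sum. -/
def pairMap (F : Type) [Field F] {G : Type} [AddCommGroup G] [Module F G] (c : Fin 3) :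
    G × G →ₗ[F] G :=
  ![LinearMap.fst F G G, LinearMap.snd F G G, LinearMap.fst F G G + LinearMap.snd F G G] c

/-- A linear section of `pairMap F c`. -/
def pairSection (F : Type) [Field F] {G : Type} [AddCommGroup G] [Module F G] (c : Fin 3) :
    G →ₗ[F] G × G :=
  ![LinearMap.inl F G G, LinearMap.inr F G G, LinearMap.inl F G G] c

lemma pairMap_pairSection (c : Fin 3) (x : G) : pairMap F c (pairSection F c x) = x := by
  fin_cases c <;> simp [pairMap, pairSection]

lemma pairMap_prodMap (φ : G →ₗ[F] H) (c : Fin 3) (z : G × G) :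
    pairMap F c (φ.prodMap φ z) = φ (pairMap F c z) := by
  fin_cases c <;> simp [pairMap]

/-- The point at which a check queries the function. -/
def checkPoint (w : Fin (k + 1) → G × G) (d : Fin 3 × (Fin k → F)) : G :=
  pairMap F d.1 (affComb d.2 w)

/-- The points queried by the tester, in order. -/
def queryPoints (ω : HomTesterCoins F G k m) : List G :=
  (List.ofFn (fun i => (ω.1 i).1) ++ List.ofFn (fun i => (ω.1 i).2)) ++
    List.ofFn fun j => checkPoint ω.1 (ω.2 j)

lemma length_queryPoints (ω : HomTesterCoins F G k m) :
    (queryPoints ω).length = 2 * (k + 1) + m := by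
  simp only [queryPoints, List.length_append, List.length_ofFn, two_mul]

open Classical in
/-- Accept if and only if some linear map is consistent with all answers that are not erased. -/
noncomputable def linearVerdict (F : Type) [Field F] {G H : Type} [AddCommGroup G] [Module F G]
    [AddCommGroup H] [Module F H] (qs : List G) (as : List (Option H)) : Bool :=
  decide (∃ φ : G →ₗ[F] H, ∀ z ∈ qs.zip as, z.2 = none ∨ z.2 = some (φ z.1))

/-- Query `k + 1` random pairs of points, then `m` random affine combinations of the first
components, of the second components, or of the sums. -/
noncomputable def homTester (F G H : Type) [Field F] [AddCommGroup G] [Module F G]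
    [AddCommGroup H] [Module F H] [Fintype F] [Fintype G] (k m : ℕ) : Tester G H :=
  (PMF.uniformOfFintype (HomTesterCoins F G k m)).map fun ω =>
    QueryAlg.queryAll (queryPoints ω) (linearVerdict F (queryPoints ω))

/-- The `d`-th check fails on the values of `f`. -/
def CheckFails (f : G → H) (w : Fin (k + 1) → G × G) (d : Fin 3 × (Fin k → F)) : Prop :=
  f (checkPoint w d) ≠ checkPoint (fun i => (f (w i).1, f (w i).2)) d

/-- A linear map consistent with all answers commutes with affine combinations and hence would make
every check succeed. -/
lemma linearVerdict_of_checkFails {f : G → H} {ω : HomTesterCoins F G k m} {j : Fin m}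
    (hj : CheckFails f ω.1 (ω.2 j)) :
    linearVerdict F (queryPoints ω) ((queryPoints ω).map fun x => some (f x)) = false := by
  simp only [linearVerdict, decide_eq_false_iff_not]
  rintro ⟨φ, hφ⟩
  have hq : ∀ x ∈ queryPoints ω, f x = φ x := by
    intro x hx
    have hmem : (x, some (f x)) ∈
        (queryPoints ω).zip ((queryPoints ω).map fun x => some (f x)) := by
      have hzip := List.zip_map' (f := id) (g := fun x => some (f x)) (l := queryPoints ω)
      rw [List.map_id] at hzip
      rw [hzip]
      exact List.mem_map_of_mem (f := fun x => (x, some (f x))) hx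
    simpa using hφ _ hmem
  refine hj ?_
  have h1 : (fun i => (f (ω.1 i).1, f (ω.1 i).2)) = fun i => φ.prodMap φ (ω.1 i) := by
    funext i
    rw [hq _ (by simp [queryPoints, -List.ofFn_succ]), hq _ (by simp [queryPoints, -List.ofFn_succ])]
    rfl
  rw [hq _ (by simp [queryPoints, -List.ofFn_succ]), h1, checkPoint, checkPoint, ← map_affComb, pairMap_prodMap]

variable [Fintype F] [Fintype G]

lemma homTester_queriesAtMost : (homTester F G H k m).QueriesAtMost (2 * (k + 1) + m) := by
  intro D hD
  rw [homTester, PMF.support_map] at hD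
  obtain ⟨ω, -, rfl⟩ := hD
  rw [← length_queryPoints ω]
  exact QueryAlg.queriesAtMost_queryAll _ _

lemma PMF.two_thirds_le_map_uniformOfFintype {Ω β : Type} [Fintype Ω] [Nonempty Ω] (g : Ω → β)
    (b : β) (S : Finset Ω) (hS : 3 * S.card ≤ Fintype.card Ω) (h : ∀ ω ∉ S, g ω = b) :
    2 / 3 ≤ (PMF.uniformOfFintype Ω).map g b := by
  classical
  rw [PMF.map_apply, tsum_fintype]
  simp only [PMF.uniformOfFintype_apply]
  have hcard : (Fintype.card Ω : ℝ≥0∞) ≠ 0 := by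
    exact_mod_cast Fintype.card_ne_zero
  calc (2 / 3 : ℝ≥0∞) ≤ (Sᶜ.card : ℝ≥0∞) * (Fintype.card Ω : ℝ≥0∞)⁻¹ := by
        rw [← div_eq_mul_inv, ENNReal.le_div_iff_mul_le (Or.inl hcard)
          (Or.inl (ENNReal.natCast_ne_top _)), ← ENNReal.mul_div_right_comm]
        refine ENNReal.div_le_of_le_mul ?_
        have h1 := Finset.card_add_card_compl S
        have h2 : 2 * Fintype.card Ω ≤ Sᶜ.card * 3 := by lia
        exact_mod_cast h2
    _ = ∑ ω ∈ Sᶜ, (Fintype.card Ω : ℝ≥0∞)⁻¹ := by simp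
    _ = ∑ ω ∈ Sᶜ, if b = g ω then (Fintype.card Ω : ℝ≥0∞)⁻¹ else 0 :=
        Finset.sum_congr rfl fun ω hω => by
          rw [if_pos (h ω (Finset.mem_compl.1 hω)).symm]
    _ ≤ ∑ ω, if b = g ω then (Fintype.card Ω : ℝ≥0∞)⁻¹ else 0 :=
        Finset.sum_le_univ_sum_of_nonneg fun _ => zero_le
    _ = _ := by congr!

lemma homTester_prob_ge (A : AdversaryStrategy G H) (b : Bool)
    (S : Finset (HomTesterCoins F G k m))
    (hS : 3 * S.card ≤ Fintype.card (HomTesterCoins F G k m))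
    (h : ∀ ω ∉ S, linearVerdict F (queryPoints ω) (A.answers [] (queryPoints ω)) = b) :
    2 / 3 ≤ (homTester F G H k m).prob A b := by
  rw [Tester.prob, homTester, PMF.map_comp]
  refine PMF.two_thirds_le_map_uniformOfFintype _ b S hS fun ω hω => ?_
  simpa only [Function.comp, QueryAlg.run_queryAll] using h ω hω

end HomTester

section HomTesterAnalysis

variable {F G H : Type} [Field F] [AddCommGroup G] [Module F G] [AddCommGroup H] [Module F H]
  {k m : ℕ}

/-- The sum check predicts its value from `f (w i).1 + f (w i).2`, so the three predictions are
additive by construction. If all were right, `f` would be additive on this pair. -/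
lemma exists_checkFails {f : G → H} {w : Fin (k + 1) → G × G} {s : Fin k → F}
    (h : f (affComb s w).1 + f (affComb s w).2 ≠ f ((affComb s w).1 + (affComb s w).2)) :
    ∃ c : Fin 3, CheckFails f w (c, s) := by
  by_contra! hcon
  simp only [CheckFails, not_not, checkPoint] at hcon
  have h0 := hcon 0
  have h1 := hcon 1
  have h2 := hcon 2
  simp only [pairMap, Matrix.cons_val_zero, Matrix.cons_val_one, Matrix.cons_val,
    LinearMap.fst_apply, LinearMap.snd_apply, LinearMap.add_apply] at h0 h1 h2
  exact h (by rw [h0, h1, h2])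

variable [Fintype F]

/-- The number of coefficient vectors of a vanishing linear combination. -/
noncomputable def relationCount (F : Type) [Field F] [Fintype F] {G : Type} [AddCommGroup G]
    [Module F G] {k : ℕ} (w : Fin (k + 1) → G × G) (c : Fin 3) : ℕ :=
  open Classical in
  (Finset.univ.filter fun b : Fin k → F => ∑ i, b i • pairMap F c (w i.succ) = 0).card

-- The check point is affine in its coefficients: a nonempty fibre is a coset of the space of
-- relations.
open Classical in
lemma card_checkPoint_eq_le (w : Fin (k + 1) → G × G) (c : Fin 3) (s : Fin k → F) (y : G) :
    (Finset.univ.filter fun z : Fin k → F => checkPoint w (c, s + z) = y).card ≤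
      relationCount F w c := by
  rcases (Finset.univ.filter fun z : Fin k → F => checkPoint w (c, s + z) = y).eq_empty_or_nonempty
    with h | ⟨z₀, h₀⟩
  · simp [h]
  · refine Finset.card_le_card_of_injOn (fun z => z - z₀) ?_ fun a _ b _ h => sub_left_injective h
    intro z hz
    simp only [Finset.coe_filter, Finset.mem_filter, Finset.mem_univ, true_and,
      Set.mem_ofPred_eq] at hz h₀ ⊢
    have h1 := hz.trans h₀.symm
    simp only [checkPoint, affComb, map_add, map_sum, map_smul, Pi.add_apply, add_smul,
      Finset.sum_add_distrib, add_right_inj] at h1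
    simp [sub_smul, h1]

variable [Fintype G]

open Classical in
lemma card_affComb_violations_le (f : G → H) (w : Fin (k + 1) → G × G) :
    (Finset.univ.filter fun s : Fin k → F => affComb s w ∈ additivityViolations f).card ≤
      (Finset.univ.filter fun d : Fin 3 × (Fin k → F) => CheckFails f w d).card := by
  have h : ∀ s : Fin k → F, ∃ c : Fin 3, affComb s w ∈ additivityViolations f →
      CheckFails f w (c, s) := by
    intro s
    by_cases hs : affComb s w ∈ additivityViolations f
    · obtain ⟨c, hc⟩ := exists_checkFails (w := w) (s := s)
        (by simpa [additivityViolations] using hs)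
      exact ⟨c, fun _ => hc⟩
    · exact ⟨0, fun h => absurd h hs⟩
  choose c hc using h
  refine Finset.card_le_card_of_injOn (fun s => (c s, s)) ?_ ?_
  · intro s hs
    simp only [Finset.coe_filter, Finset.mem_univ, true_and, Set.mem_ofPred_eq] at hs ⊢
    exact hc s hs
  · intro s _ s' _ h
    exact (Prod.mk.inj h).2

open Classical in
/-- The probability that no check of the tester fails on the unmanipulated function. -/
theorem card_no_checkFails_le (f : G → H) {ρ : ℝ} (hρ0 : 0 < ρ)
    (hρ : ((additivityViolations f).card : ℝ) = ρ * (Fintype.card G : ℝ) ^ 2) :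
    ((Finset.univ.filter fun ω : HomTesterCoins F G k m =>
        ∀ j, ¬ CheckFails f ω.1 (ω.2 j)).card : ℝ) ≤
      (4 / (ρ * (Fintype.card F : ℝ) ^ k) + Real.exp (-(ρ * m / 6))) *
        Fintype.card (HomTesterCoins F G k m) := by
  set V := additivityViolations f
  set N : ℝ := (Fintype.card F : ℝ) ^ k with hN
  have hNcard : ((Fintype.card (Fin k → F) : ℕ) : ℝ) = N := by simp [hN]
  have hNpos : 0 < N := by
    rw [hN]
    have : (0 : ℝ) < Fintype.card F := by exact_mod_cast Fintype.card_pos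
    positivity
  set D := Fin 3 × (Fin k → F)
  have hD : ((Fintype.card D : ℕ) : ℝ) = 3 * N := by
    simp [D, hN]
  set M : ℝ := (Fintype.card (Fin (k + 1) → G × G) : ℝ) with hM
  have hΩ : ((Fintype.card (HomTesterCoins F G k m) : ℕ) : ℝ) = M * (3 * N) ^ m := by
    rw [Fintype.card_prod, Nat.cast_mul, ← hM, Fintype.card_fun, Nat.cast_pow, hD, Fintype.card_fin]
  set Low := Finset.univ.filter fun w : Fin (k + 1) → G × G =>
    ((Finset.univ.filter fun s : Fin k → F => affComb s w ∈ V).card : ℝ) ≤ ρ * N / 2 with hLow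
  have hLowcard : (Low.card : ℝ) * (ρ * N) ≤ 4 * M := by
    have := card_filter_affComb_hits_le (F := F) (k := k) V (ρ := ρ)
      (by rw [hρ, Fintype.card_prod]; push_cast; ring)
    rw [hNcard] at this
    convert this
  have hpass : ∀ w, ((Finset.univ.filter fun a : Fin m → D => ∀ j, ¬ CheckFails f w (a j)).card : ℝ)
      = ((Finset.univ.filter fun d : D => ¬ CheckFails f w d).card : ℝ) ^ m := by
    intro w
    have : (Finset.univ.filter fun a : Fin m → D => ∀ j, ¬ CheckFails f w (a j)) =
        Fintype.piFinset fun _ => Finset.univ.filter fun d : D => ¬ CheckFails f w d := by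
      ext a; simp
    rw [this, Fintype.card_piFinset_const, Nat.cast_pow]
  have hle : ∀ w, ((Finset.univ.filter fun a : Fin m → D => ∀ j, ¬ CheckFails f w (a j)).card : ℝ)
      ≤ (if w ∈ Low then (3 * N) ^ m else 0) + (3 * N) ^ m * Real.exp (-(ρ * m / 6)) := by
    intro w
    rw [hpass]
    have hsplit : ((Finset.univ.filter fun d : D => CheckFails f w d).card : ℝ) +
        (Finset.univ.filter fun d : D => ¬ CheckFails f w d).card = 3 * N := by
      rw [← hD]
      exact_mod_cast Finset.card_filter_add_card_filter_not (s := Finset.univ) (CheckFails f w)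
    set R : ℝ := ((Finset.univ.filter fun d : D => CheckFails f w d).card : ℝ)
    have hR0 : 0 ≤ R := Nat.cast_nonneg _
    split_ifs with hw
    · have h1 : ((Finset.univ.filter fun d : D => ¬ CheckFails f w d).card : ℝ) ^ m ≤
          (3 * N) ^ m := pow_le_pow_left₀ (Nat.cast_nonneg _) (by linarith) m
      have : 0 ≤ (3 * N) ^ m * Real.exp (-(ρ * m / 6)) := by positivity
      linarith
    · have hX : ρ * N / 2 < R := by
        simp only [hLow, Finset.mem_filter, Finset.mem_univ, true_and, not_le] at hw
        refine lt_of_lt_of_le hw ?_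
        exact Nat.cast_le.2 (card_affComb_violations_le f w)
      -- At most `3 * N - ρ * N / 2 = 3 * N * (1 - ρ / 6)` checks succeed.
      have h2 : ((Finset.univ.filter fun d : D => ¬ CheckFails f w d).card : ℝ) ≤
          3 * N * Real.exp (-(ρ / 6)) := by
        have := Real.add_one_le_exp (-(ρ / 6))
        nlinarith
      rw [zero_add]
      calc _ ≤ (3 * N * Real.exp (-(ρ / 6))) ^ m := pow_le_pow_left₀ (Nat.cast_nonneg _) h2 m
        _ = _ := by
          rw [mul_pow, ← Real.exp_nat_mul]
          ring_nf
  have hsum : ((Finset.univ.filter fun ω : HomTesterCoins F G k m =>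
        ∀ j, ¬ CheckFails f ω.1 (ω.2 j)).card : ℝ) =
      ∑ w : Fin (k + 1) → G × G,
        ((Finset.univ.filter fun a : Fin m → D => ∀ j, ¬ CheckFails f w (a j)).card : ℝ) := by
    rw [← Nat.cast_sum]
    congr 1
    simp only [Finset.card_filter]
    rw [Fintype.sum_prod_type]
  rw [hsum, hΩ]
  refine (Finset.sum_le_sum fun w _ => hle w).trans ?_
  rw [Finset.sum_add_distrib, Finset.sum_const, Finset.card_univ, nsmul_eq_mul, ← hM,
    Finset.sum_ite_mem, Finset.univ_inter, Finset.sum_const, nsmul_eq_mul]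
  have h3 : (Low.card : ℝ) ≤ 4 / (ρ * N) * M := by
    rw [div_mul_eq_mul_div, le_div_iff₀ (by positivity)]
    exact hLowcard
  have h4 : (0 : ℝ) ≤ (3 * N) ^ m := by positivity
  nlinarith [mul_le_mul_of_nonneg_right h3 h4]

/-- The vector `b = 0` is always a relation. For `b i ≠ 0`, translating `w i.succ` along
`pairSection` makes the combination uniform on `G`, so it vanishes with probability `1 / |G|`. -/
lemma card_mul_sum_relationCount_le (c : Fin 3) :
    Fintype.card G * ∑ w : Fin (k + 1) → G × G, relationCount F w c ≤
      (Fintype.card G + Fintype.card F ^ k) * Fintype.card (Fin (k + 1) → G × G) := by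
  classical
  have hswap : ∑ w : Fin (k + 1) → G × G, relationCount F w c = ∑ b : Fin k → F,
      (Finset.univ.filter fun w : Fin (k + 1) → G × G =>
        ∑ i, b i • pairMap F c (w i.succ) = 0).card := by
    simp only [relationCount, Finset.card_filter]
    rw [Finset.sum_comm]
  have hb : ∀ b : Fin k → F, Fintype.card G * (Finset.univ.filter fun w : Fin (k + 1) → G × G =>
      ∑ i, b i • pairMap F c (w i.succ) = 0).card ≤
      ((if b = 0 then Fintype.card G else 0) + 1) * Fintype.card (Fin (k + 1) → G × G) := by
    intro b
    split_ifs with h0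
    · refine le_trans (Nat.mul_le_mul_left _ (Finset.card_le_univ _)) ?_
      exact Nat.mul_le_mul_right _ (Nat.le_succ _)
    · obtain ⟨i, hi⟩ := Function.ne_iff.1 h0
      refine (card_mul_card_filter_le
        (fun z : G => Equiv.addRight (Pi.single i.succ (pairSection F c z))) _
        (fun _ => 1) fun w => ?_).trans (by simp)
      rw [Finset.card_le_one]
      intro z hz z' hz'
      have hcomp : ∀ z : G, ∑ j, b j • pairMap F c
          ((w + Pi.single i.succ (pairSection F c z) : Fin (k + 1) → G × G) j.succ) =
          ∑ j, b j • pairMap F c (w j.succ) + b i • z := by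
        intro z
        have hj : ∀ j : Fin k, b j • pairMap F c
            ((Pi.single i.succ (pairSection F c z) : Fin (k + 1) → G × G) j.succ) =
            if j = i then b i • z else 0 := by
          intro j
          by_cases hj : j = i
          · subst hj; simp [pairMap_pairSection]
          · simp [hj]
        simp [hj, smul_add, Finset.sum_add_distrib]
      simp only [Finset.mem_filter, Finset.mem_univ, true_and, Equiv.coe_addRight, hcomp] at hz hz'
      have h1 : b i • z = b i • z' := add_left_cancel (hz.trans hz'.symm)
      exact smul_right_injective G hi h1
  rw [hswap, Finset.mul_sum]
  refine (Finset.sum_le_sum fun b _ => hb b).trans (le_of_eq ?_)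
  rw [← Finset.sum_mul, Finset.sum_add_distrib]
  simp

open Classical in
/-- The probability that the tester queries a manipulated point. -/
theorem IsBudgetManaging.card_hitsManipulated_le {R : Type} [DecidableEq R] {t : ℕ} {f : G → R}
    {A : AdversaryStrategy G R} (hA : IsBudgetManaging t f A) :
    Fintype.card G * Fintype.card F ^ k * (Finset.univ.filter fun ω : HomTesterCoins F G k m =>
        A.HitsManipulated f [] (queryPoints ω)).card ≤
      3 * t * (2 * (k + 1) + m) ^ 2 * (Fintype.card G + Fintype.card F ^ k) *
        Fintype.card (HomTesterCoins F G k m) := by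
  set Ω := HomTesterCoins F G k m
  set g := Fintype.card G
  set N := Fintype.card F ^ k
  set q := 2 * (k + 1) + m with hq
  set T := Fintype.card Ω with hT
  let h₁ : Fin (k + 1) → Ω → List G := fun i ω => ((List.ofFn fun i => (ω.1 i).1).take i).reverse
  let h₂ : Fin (k + 1) → Ω → List G := fun i ω =>
    ((List.ofFn fun i => (ω.1 i).2).take i).reverse ++ (List.ofFn fun i => (ω.1 i).1).reverse
  let h₃ : Fin m → Ω → List G := fun j ω =>
    ((List.ofFn fun j => checkPoint ω.1 (ω.2 j)).take j).reverse ++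
      ((List.ofFn fun i => (ω.1 i).1) ++ List.ofFn fun i => (ω.1 i).2).reverse
  let E₁ : Fin (k + 1) → Finset Ω := fun i =>
    Finset.univ.filter fun ω => A (h₁ i ω) (ω.1 i).1 ≠ some (f (ω.1 i).1)
  let E₂ : Fin (k + 1) → Finset Ω := fun i =>
    Finset.univ.filter fun ω => A (h₂ i ω) (ω.1 i).2 ≠ some (f (ω.1 i).2)
  let E₃ : Fin m → Finset Ω := fun j =>
    Finset.univ.filter fun ω => A (h₃ j ω) (checkPoint ω.1 (ω.2 j)) ≠
      some (f (checkPoint ω.1 (ω.2 j)))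
  have hcover : (Finset.univ.filter fun ω : Ω => A.HitsManipulated f [] (queryPoints ω)) ⊆
      (Finset.univ.biUnion E₁ ∪ Finset.univ.biUnion E₂) ∪ Finset.univ.biUnion E₃ := by
    intro ω hω
    simp only [Finset.mem_filter, Finset.mem_univ, true_and, queryPoints,
      AdversaryStrategy.hitsManipulated_append, AdversaryStrategy.hitsManipulated_ofFn,
      List.append_nil] at hω
    simpa only [E₁, E₂, E₃, h₁, h₂, h₃, Finset.mem_union, Finset.mem_biUnion, Finset.mem_filter,
      Finset.mem_univ, true_and] using hω
  have hE₁ : ∀ i, g * (E₁ i).card ≤ t * q * T := by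
    intro i
    refine (hA.card_hits_le (q := q) (fun z : G => (Equiv.addRight
      (Pi.single i (z, 0) : Fin (k + 1) → G × G)).prodCongr (Equiv.refl (Fin m → Fin 3 × (Fin k → F))))
      (h₁ i) (fun ω => (ω.1 i).1) (fun _ => 1) ?_ ?_ ?_).trans (by simp [hT, Ω])
    · intro ω
      simp only [h₁, List.length_reverse, List.length_take, List.length_ofFn]
      lia
    · intro z ω
      simp only [h₁]
      congr 1
      refine List.take_ofFn_congr i fun j hj => ?_
      simp [hj.ne]
    · intro ω y
      rw [Finset.card_le_one]
      intro z hz z' hz'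
      simp only [Finset.mem_filter, Finset.mem_univ, true_and, Equiv.prodCongr_apply, Prod.map_fst,
        Equiv.coe_addRight, Pi.add_apply, Pi.single_eq_same, Prod.fst_add] at hz hz'
      exact add_left_cancel (hz.trans hz'.symm)
  -- The history now contains all first components, so only the second component of the pair is
  -- resampled.
  have hE₂ : ∀ i, g * (E₂ i).card ≤ t * q * T := by
    intro i
    refine (hA.card_hits_le (q := q) (fun z : G => (Equiv.addRight
      (Pi.single i (0, z) : Fin (k + 1) → G × G)).prodCongr (Equiv.refl (Fin m → Fin 3 × (Fin k → F))))
      (h₂ i) (fun ω => (ω.1 i).2) (fun _ => 1) ?_ ?_ ?_).trans (by simp [hT, Ω])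
    · intro ω
      simp only [h₂, List.length_append, List.length_reverse, List.length_take, List.length_ofFn]
      lia
    · intro z ω
      simp only [h₂]
      congr 1
      · congr 1
        refine List.take_ofFn_congr i fun j hj => ?_
        simp [hj.ne]
      · congr 2
        funext j
        by_cases hj : j = i
        · subst hj; simp
        · simp [hj]
    · intro ω y
      rw [Finset.card_le_one]
      intro z hz z' hz'
      simp only [Finset.mem_filter, Finset.mem_univ, true_and, Equiv.prodCongr_apply, Prod.map_fst,
        Equiv.coe_addRight, Pi.add_apply, Pi.single_eq_same, Prod.snd_add] at hz hz'
      exact add_left_cancel (hz.trans hz'.symm)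
  have hK : g * ∑ ω : Ω, ∑ c, relationCount F ω.1 c ≤ 3 * (g + N) * T := by
    rw [Fintype.sum_prod_type]
    simp only [Finset.sum_const, Finset.card_univ, smul_eq_mul]
    rw [← Finset.mul_sum, Finset.sum_comm, hT, Fintype.card_prod]
    calc _ = Fintype.card (Fin m → Fin 3 × (Fin k → F)) *
          ∑ c, g * ∑ w : Fin (k + 1) → G × G, relationCount F w c := by
            rw [← Finset.mul_sum]; ring
      _ ≤ Fintype.card (Fin m → Fin 3 × (Fin k → F)) *
          ∑ _c : Fin 3, (g + N) * Fintype.card (Fin (k + 1) → G × G) :=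
            Nat.mul_le_mul_left _ (Finset.sum_le_sum fun c _ => card_mul_sum_relationCount_le c)
      _ = _ := by
            rw [Finset.sum_const, Finset.card_univ, Fintype.card_fin, smul_eq_mul]; ring
  -- The pool is already revealed; only the coefficients of check `j` are resampled. Summing over
  -- the three kinds makes the bound depend on the pool alone.
  have hE₃ : ∀ j, N * (E₃ j).card ≤ t * q * ∑ ω : Ω, ∑ c, relationCount F ω.1 c := by
    intro j
    have key := hA.card_hits_le (q := q) (fun z : Fin k → F =>
      (Equiv.refl (Fin (k + 1) → G × G)).prodCongr (Equiv.addRight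
        (Pi.single j (0, z) : Fin m → Fin 3 × (Fin k → F))))
      (h₃ j) (fun ω => checkPoint ω.1 (ω.2 j)) (fun ω => ∑ c, relationCount F ω.1 c) ?_ ?_ ?_
    · rwa [Fintype.card_fun, Fintype.card_fin] at key
    · intro ω
      simp only [h₃, List.length_append, List.length_reverse, List.length_take, List.length_ofFn]
      lia
    · intro z ω
      simp only [h₃]
      congr 1
      congr 1
      refine List.take_ofFn_congr j fun i hi => ?_
      simp [hi.ne]
    · intro ω y
      refine le_trans ?_ (Finset.single_le_sum (f := fun c => relationCount F ω.1 c)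
        (fun _ _ => Nat.zero_le _) (Finset.mem_univ (ω.2 j).1))
      refine le_trans (le_of_eq ?_) (card_checkPoint_eq_le ω.1 (ω.2 j).1 (ω.2 j).2 y)
      congr! 3
      refine congrArg _ (Prod.ext ?_ ?_) <;> simp
  have hcard := (Finset.card_le_card hcover).trans ((Finset.card_union_le _ _).trans
    (add_le_add ((Finset.card_union_le _ _).trans (add_le_add Finset.card_biUnion_le
      Finset.card_biUnion_le)) Finset.card_biUnion_le))
  set X := (Finset.univ.filter fun ω : Ω => A.HitsManipulated f [] (queryPoints ω)).card
  have b₁ : g * N * ∑ i, (E₁ i).card ≤ (k + 1) * (3 * (t * q) * (g + N) * T) := by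
    calc g * N * ∑ i, (E₁ i).card = N * ∑ i, g * (E₁ i).card := by rw [← Finset.mul_sum]; ring
      _ ≤ N * ∑ _i : Fin (k + 1), t * q * T :=
          Nat.mul_le_mul_left _ (Finset.sum_le_sum fun i _ => hE₁ i)
      _ = (k + 1) * (t * q * T * N) := by simp; ring
      _ ≤ _ := Nat.mul_le_mul_left _ (by
        nlinarith [Nat.zero_le (t * q * T * N), Nat.zero_le (t * q * T * g)])
  have b₂ : g * N * ∑ i, (E₂ i).card ≤ (k + 1) * (3 * (t * q) * (g + N) * T) := by
    calc g * N * ∑ i, (E₂ i).card = N * ∑ i, g * (E₂ i).card := by rw [← Finset.mul_sum]; ring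
      _ ≤ N * ∑ _i : Fin (k + 1), t * q * T :=
          Nat.mul_le_mul_left _ (Finset.sum_le_sum fun i _ => hE₂ i)
      _ = (k + 1) * (t * q * T * N) := by simp; ring
      _ ≤ _ := Nat.mul_le_mul_left _ (by
        nlinarith [Nat.zero_le (t * q * T * N), Nat.zero_le (t * q * T * g)])
  have b₃ : g * N * ∑ j, (E₃ j).card ≤ m * (3 * (t * q) * (g + N) * T) := by
    calc g * N * ∑ j, (E₃ j).card = g * ∑ j, N * (E₃ j).card := by rw [← Finset.mul_sum]; ring
      _ ≤ g * ∑ _j : Fin m, t * q * ∑ ω : Ω, ∑ c, relationCount F ω.1 c :=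
          Nat.mul_le_mul_left _ (Finset.sum_le_sum fun j _ => hE₃ j)
      _ = m * (t * q * (g * ∑ ω : Ω, ∑ c, relationCount F ω.1 c)) := by
          rw [Finset.sum_const, Finset.card_univ, Fintype.card_fin, smul_eq_mul]; ring
      _ ≤ m * (t * q * (3 * (g + N) * T)) := by gcongr
      _ = _ := by ring
  calc g * N * X ≤ g * N * (∑ i, (E₁ i).card + ∑ i, (E₂ i).card + ∑ j, (E₃ j).card) :=
        Nat.mul_le_mul_left _ hcard
    _ ≤ (k + 1) * (3 * (t * q) * (g + N) * T) + (k + 1) * (3 * (t * q) * (g + N) * T) +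
        m * (3 * (t * q) * (g + N) * T) := by
        rw [mul_add, mul_add]
        exact add_le_add (add_le_add b₁ b₂) b₃
    _ = 3 * t * q ^ 2 * (g + N) * T := by rw [hq]; ring

end HomTesterAnalysis

/-! ### Parameters -/

lemma ten_thousand_mul_sq_le_two_pow {s : ℕ} (hs : 108 ≤ s) : 10000 * s ^ 2 ≤ 2 ^ s := by
  induction s, hs using Nat.le_induction with
  | base => norm_num
  | succ s hs ih => rw [pow_succ 2]; nlinarith

/-- For `t = 0` both `Nat.clog` and `Real.logb` take the value `0`. -/
lemma clog_le_logb_add_one {p : ℕ} (hp : 1 < p) (t : ℕ) :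
    0 ≤ Real.logb p t ∧ (Nat.clog p t : ℝ) ≤ Real.logb p t + 1 := by
  rcases Nat.eq_zero_or_pos t with rfl | ht
  · simp
  · have h0 : 0 ≤ Real.logb p t :=
      Real.logb_nonneg (by exact_mod_cast hp) (by exact_mod_cast ht)
    refine ⟨h0, ?_⟩
    rw [← Real.natCeil_logb_natCast]
    exact (Nat.ceil_lt_add_one h0).le

lemma checks_card_bounds {ε : ℝ} (hε0 : 0 < ε) (hε1 : ε < 1) :
    108 ≤ ⌈108 / ε⌉₊ ∧ (108 : ℝ) ≤ ε * ⌈108 / ε⌉₊ ∧ ε * ⌈108 / ε⌉₊ ≤ 109 := by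
  have h1 : 108 / ε ≤ ⌈108 / ε⌉₊ := Nat.le_ceil _
  have h2 : (⌈108 / ε⌉₊ : ℝ) < 108 / ε + 1 := Nat.ceil_lt_add_one (by positivity)
  have h3 : 108 ≤ ε * ⌈108 / ε⌉₊ := by
    rw [div_le_iff₀ hε0] at h1
    linarith
  refine ⟨?_, h3, ?_⟩
  · have : (108 : ℝ) ≤ ⌈108 / ε⌉₊ := by nlinarith
    exact_mod_cast this
  · have h4 := mul_lt_mul_of_pos_left h2 hε0
    rw [mul_add, mul_div_cancel₀ _ hε0.ne'] at h4
    linarith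

/-- The relation between the manipulation rate, the number of queries and the size of the
domain. -/
lemma rate_mul_queries_sq_le {p : ℕ} (hp : 2 ≤ p) {n t : ℕ} {ε : ℝ} (hε0 : 0 < ε) (hε1 : ε < 1)
    (ht : (t : ℝ) ≤ 1 / 10 ^ 9 * min (ε ^ 2) (1 / (n : ℝ) ^ 2) * (p : ℝ) ^ n) {L m k : ℕ}
    (hL : L = Nat.clog p t) (hm : m = ⌈108 / ε⌉₊) (hk : k = 2 * L + m) :
    300 * (t * (2 * (k + 1) + m) ^ 2) ≤ p ^ k ∧ 300 * (t * (2 * (k + 1) + m) ^ 2) ≤ p ^ n := by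
  obtain ⟨hm1, -, hm3⟩ := checks_card_bounds hε0 hε1
  rw [← hm] at hm1 hm3
  -- The left side is `4 * L + 3 * m + 2`, so `2 ≤ m` is enough.
  have hq : 2 * (k + 1) + m ≤ 4 * (L + m) := by lia
  have hq2 : (2 * (k + 1) + m) ^ 2 ≤ 16 * (L + m) ^ 2 :=
    (Nat.pow_le_pow_left hq 2).trans (by rw [mul_pow]; norm_num)
  constructor
  · have h1 : t ≤ p ^ L := hL ▸ Nat.le_pow_clog (by lia) t
    have h2 := ten_thousand_mul_sq_le_two_pow (s := L + m) (by lia)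
    have h3 : 2 ^ (L + m) ≤ p ^ (L + m) := Nat.pow_le_pow_left hp _
    calc 300 * (t * (2 * (k + 1) + m) ^ 2) ≤ 300 * (t * (16 * (L + m) ^ 2)) := by gcongr
      _ ≤ t * (10000 * (L + m) ^ 2) := by nlinarith [Nat.zero_le (t * (L + m) ^ 2)]
      _ ≤ p ^ L * p ^ (L + m) := Nat.mul_le_mul h1 (h2.trans h3)
      _ = p ^ k := by rw [hk, ← pow_add]; congr 1; ring
  · have hg : (0 : ℝ) < (p : ℝ) ^ n := by
      have : (0 : ℝ) < p := by exact_mod_cast (by lia : 0 < p)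
      positivity
    have ht1 : (t : ℝ) ≤ 1 / 10 ^ 9 * ε ^ 2 * (p : ℝ) ^ n :=
      ht.trans (by gcongr; exact min_le_left _ _)
    have htm : (t : ℝ) * m ^ 2 ≤ 11881 / 10 ^ 9 * (p : ℝ) ^ n := by
      calc (t : ℝ) * m ^ 2 ≤ 1 / 10 ^ 9 * ε ^ 2 * (p : ℝ) ^ n * m ^ 2 := by gcongr
        _ = 1 / 10 ^ 9 * (ε * m) ^ 2 * (p : ℝ) ^ n := by ring
        _ ≤ 1 / 10 ^ 9 * 109 ^ 2 * (p : ℝ) ^ n := by gcongr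
        _ = _ := by norm_num
    -- This lets the `1 / n ^ 2` in the hypothesis absorb the factor `L ^ 2`.
    have hLn : L ≤ n := by
      rw [hL]
      refine Nat.clog_le_of_le_pow ?_
      have : (t : ℝ) ≤ (p : ℝ) ^ n := by
        refine ht1.trans ?_
        have : ε ^ 2 ≤ 1 := by nlinarith
        nlinarith
      exact_mod_cast this
    have htL : (t : ℝ) * L ^ 2 ≤ 1 / 10 ^ 9 * (p : ℝ) ^ n := by
      rcases Nat.eq_zero_or_pos n with rfl | hn
      · have : L = 0 := by lia
        rw [this]
        norm_num
      · have hn' : (0 : ℝ) < n := by exact_mod_cast hn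
        calc (t : ℝ) * L ^ 2 ≤ (1 / 10 ^ 9 * (1 / (n : ℝ) ^ 2) * (p : ℝ) ^ n) * n ^ 2 := by
              gcongr
              exact ht.trans (by gcongr; exact min_le_right _ _)
          _ = _ := by field_simp
    have hfin : (300 * (t * (2 * (k + 1) + m) ^ 2 : ℕ) : ℝ) ≤ (p : ℝ) ^ n := by
      calc (300 * (t * (2 * (k + 1) + m) ^ 2 : ℕ) : ℝ) ≤ 300 * (t * (16 * (L + m) ^ 2) : ℕ) := by
            gcongr
        _ = 4800 * (t * ((L : ℝ) + m) ^ 2) := by push_cast; ring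
        _ ≤ 4800 * (2 * (t * L ^ 2) + 2 * (t * m ^ 2)) := by
            nlinarith [mul_nonneg (Nat.cast_nonneg (α := ℝ) t) (sq_nonneg ((L : ℝ) - m))]
        _ ≤ _ := by nlinarith
    exact_mod_cast hfin

/-- The number 108 is chosen so that `ρ * m ≥ 108 / 6 = 18`, making the exponential at most `exp
(-3)`. The Chebyshev term is small because `N` is exponential in `m`. -/
lemma no_failed_check_bound {ε ρ : ℝ} (hε0 : 0 < ε) (hε1 : ε < 1) (hρ : ε / 6 ≤ ρ) {N : ℝ}
    (hN : (2 : ℝ) ^ ⌈108 / ε⌉₊ ≤ N) :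
    4 / (ρ * N) + Real.exp (-(ρ * ⌈108 / ε⌉₊ / 6)) ≤ 1 / 8 := by
  obtain ⟨hm1, hm2, -⟩ := checks_card_bounds hε0 hε1
  set m := ⌈108 / ε⌉₊
  have hmR : (108 : ℝ) ≤ m := by exact_mod_cast hm1
  have h1 : (10000 * (m : ℝ) ^ 2) ≤ N := le_trans
    (by exact_mod_cast ten_thousand_mul_sq_le_two_pow hm1) hN
  have hρm : 18 ≤ ρ * m := by nlinarith
  have h2 : 4 / (ρ * N) ≤ 1 / 16 := by
    have : 64 ≤ ρ * N := by
      have hρ0 : 0 < ρ := by linarith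
      have h3 : ρ * (10000 * (m : ℝ) ^ 2) ≤ ρ * N := mul_le_mul_of_nonneg_left h1 hρ0.le
      nlinarith
    rw [div_le_iff₀ (by linarith)]
    linarith
  have h3 : Real.exp (-(ρ * m / 6)) ≤ 1 / 16 := by
    calc Real.exp (-(ρ * m / 6)) ≤ Real.exp (-3) := Real.exp_le_exp.2 (by linarith)
      _ = (Real.exp 1 ^ 3)⁻¹ := by rw [← Real.exp_nat_mul, ← Real.exp_neg]; norm_num
      _ ≤ (16 : ℝ)⁻¹ := by
          refine inv_anti₀ (by norm_num) ?_
          have := Real.exp_one_gt_d9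
          calc (16 : ℝ) ≤ 2.7 ^ 3 := by norm_num
            _ ≤ Real.exp 1 ^ 3 := pow_le_pow_left₀ (by norm_num) (by linarith) 3
      _ = 1 / 16 := by norm_num
  linarith

/-! ### Correctness -/

section Correctness

variable {F G H : Type} [Field F] [AddCommGroup G] [Module F G] [AddCommGroup H] [Module F H]
  {k m : ℕ}

lemma linearVerdict_map (φ : G →ₗ[F] H) (qs : List G) :
    linearVerdict F qs (qs.map fun x => some (φ x)) = true := by
  simp only [linearVerdict, decide_eq_true_eq]
  refine ⟨φ, fun z hz => Or.inr ?_⟩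
  have hzip := List.zip_map' (f := id) (g := fun x => some (φ x)) (l := qs)
  rw [List.map_id] at hzip
  rw [hzip] at hz
  obtain ⟨x, -, rfl⟩ := List.mem_map.1 hz
  rfl

variable [Fintype F] [Fintype G] [DecidableEq H]

lemma homTester_hasOneSidedError (t : ℕ) {P : Set (G → H)}
    (hP : ∀ f ∈ P, ∃ φ : G →ₗ[F] H, f = φ) :
    HasOneSidedError P (erasureAdversaries t) (homTester F G H k m) := by
  intro f hf A hA D hD
  obtain ⟨φ, rfl⟩ := hP f hf
  rw [homTester, PMF.support_map] at hD
  obtain ⟨ω, -, rfl⟩ := hD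
  simp only [QueryAlg.run_queryAll, linearVerdict, decide_eq_true_eq]
  exact ⟨φ, AdversaryStrategy.eq_none_or_of_mem_zip_answers
    (eq_none_or_of_mem_erasureAdversaries hA) _ _⟩

/-- If manipulated points are rarely hit and checks rarely all succeed on far functions, then the
tester is correct in the presence of budget-managing adversaries. -/
lemma homTester_isOnlineTester {ε : ℝ} {t : ℕ} {P : Set (G → H)}
    (hP : ∀ f ∈ P, ∃ φ : G →ₗ[F] H, f = φ) {adv : (G → H) → Set (AdversaryStrategy G H)}
    (hadv : ∀ f, ∀ A ∈ adv f, IsBudgetManaging t f A)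
    (hk : 300 * (t * (2 * (k + 1) + m) ^ 2) ≤ Fintype.card F ^ k)
    (hg : 300 * (t * (2 * (k + 1) + m) ^ 2) ≤ Fintype.card G)
    (hfar : ∀ f : G → H, IsFar ε f P → ∃ ρ : ℝ, 0 < ρ ∧
      ((additivityViolations f).card : ℝ) = ρ * (Fintype.card G : ℝ) ^ 2 ∧
      4 / (ρ * (Fintype.card F : ℝ) ^ k) + Real.exp (-(ρ * m / 6)) ≤ 1 / 8) :
    IsOnlineTester ε P adv (homTester F G H k m) := by
  classical
  intro f A hA
  have hbm := hadv f A hA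
  set hit := Finset.univ.filter fun ω : HomTesterCoins F G k m =>
    A.HitsManipulated f [] (queryPoints ω) with hhit
  have hhitcard : 50 * hit.card ≤ Fintype.card (HomTesterCoins F G k m) := by
    have h1 : Fintype.card G * Fintype.card F ^ k * hit.card ≤
        3 * t * (2 * (k + 1) + m) ^ 2 * (Fintype.card G + Fintype.card F ^ k) *
          Fintype.card (HomTesterCoins F G k m) := by
      have := hbm.card_hitsManipulated_le (F := F) (k := k) (m := m)
      convert this
    set T := Fintype.card (HomTesterCoins F G k m)
    set q2 := t * (2 * (k + 1) + m) ^ 2 with hq2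
    have hpos : 0 < Fintype.card G * Fintype.card F ^ k :=
      Nat.mul_pos Fintype.card_pos (pow_pos Fintype.card_pos k)
    set g := Fintype.card G
    set N := Fintype.card F ^ k
    refine Nat.le_of_mul_le_mul_left ?_ hpos
    -- Each of `g` and `N` is at least `300 * q2`; adding the two bounds halves the constant.
    have h2 : 150 * q2 * (g + N) ≤ g * N := by
      have h3 := Nat.mul_le_mul_right g hk
      have h4 := Nat.mul_le_mul_right N hg
      nlinarith
    calc g * N * (50 * hit.card) = 50 * (g * N * hit.card) := by ring
      _ ≤ 50 * (3 * t * (2 * (k + 1) + m) ^ 2 * (g + N) * T) := Nat.mul_le_mul_left _ h1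
      _ = 150 * q2 * (g + N) * T := by rw [hq2]; ring
      _ ≤ g * N * T := Nat.mul_le_mul_right _ h2
  have hans : ∀ ω ∉ hit, A.answers [] (queryPoints ω) =
      (queryPoints ω).map fun x => some (f x) := by
    intro ω hω
    exact AdversaryStrategy.answers_eq_map _ _ (by simpa [hhit] using hω)
  constructor
  · intro hf
    obtain ⟨φ, rfl⟩ := hP f hf
    refine homTester_prob_ge A true hit (by lia) fun ω hω => ?_
    rw [hans ω hω, linearVerdict_map]
  · intro hf
    obtain ⟨ρ, hρ0, hρ, hbound⟩ := hfar f hf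
    set pass := Finset.univ.filter fun ω : HomTesterCoins F G k m =>
      ∀ j, ¬ CheckFails f ω.1 (ω.2 j) with hpass
    have hpasscard : 8 * pass.card ≤ Fintype.card (HomTesterCoins F G k m) := by
      have h1 : (pass.card : ℝ) ≤
          (4 / (ρ * (Fintype.card F : ℝ) ^ k) + Real.exp (-(ρ * m / 6))) *
            Fintype.card (HomTesterCoins F G k m) := by
        have := card_no_checkFails_le (F := F) (k := k) (m := m) f hρ0 hρ
        convert this
      have h2 := mul_le_mul_of_nonneg_right hbound
        (Nat.cast_nonneg (α := ℝ) (Fintype.card (HomTesterCoins F G k m)))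
      have h3 : (8 * pass.card : ℝ) ≤ Fintype.card (HomTesterCoins F G k m) := by linarith
      exact_mod_cast h3
    refine homTester_prob_ge A false (hit ∪ pass) ?_ fun ω hω => ?_
    -- The total error is at most `1 / 50 + 1 / 8 < 1 / 3`.
    · have := Finset.card_union_le hit pass
      lia
    · rw [Finset.mem_union, not_or] at hω
      obtain ⟨j, hj⟩ : ∃ j, CheckFails f ω.1 (ω.2 j) := by simpa [hpass] using hω.2
      rw [hans ω hω.1, linearVerdict_of_checkFails hj]

end Correctness

theorem theorem1p5 :
    ∃ c C : ℝ, 0 < c ∧ 0 < C ∧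
      ∀ (p : ℕ) [Fact p.Prime] (n r : ℕ) (ε : ℝ), 0 < ε → ε < 1 →
      ∀ t : ℕ, (t : ℝ) ≤ c * min (ε ^ 2) (1 / (n : ℝ) ^ 2) * (p : ℝ) ^ n →
        ∃ T : Tester (Fin n → ZMod p) (Fin r → ZMod p),
          (∃ q : ℕ, (q : ℝ) ≤ C * (1 / ε + Real.logb p t) ∧ T.QueriesAtMost q) ∧
          IsOnlineTester ε (homProperty (Fin n → ZMod p) (Fin r → ZMod p))
            (erasureAdversaries t) T ∧
          HasOneSidedError (homProperty (Fin n → ZMod p) (Fin r → ZMod p))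
            (erasureAdversaries t) T ∧
          IsOnlineTester ε (homProperty (Fin n → ZMod p) (Fin r → ZMod p))
            (corruptionAdversaries t) T := by
  -- The query count is at most `4 * (L + m)` with `L ≤ logb p t + 1` and `m ≤ 109 / ε`, and `4 *
  -- 109 + 4 = 440`.
  refine ⟨1 / 10 ^ 9, 440, by norm_num, by norm_num, ?_⟩
  intro p hp n r ε hε0 hε1 t ht
  have hp2 : 2 ≤ p := hp.out.two_le
  set L := Nat.clog p t with hL
  set m := ⌈108 / ε⌉₊ with hm
  -- One factor `p ^ L` of `p ^ k` outweighs `t`; the other `p ^ (L + m)` outweighs the squared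
  -- number of queries.
  set k := 2 * L + m with hk
  obtain ⟨hrk, hrn⟩ := rate_mul_queries_sq_le hp2 hε0 hε1 ht hL hm hk
  obtain ⟨hm1, -, hm3⟩ := checks_card_bounds hε0 hε1
  have hcardG : Fintype.card (Fin n → ZMod p) = p ^ n := by simp [ZMod.card]
  -- Over a prime field additive maps are linear, so testing against linear maps loses nothing.
  have hP : ∀ f ∈ homProperty (Fin n → ZMod p) (Fin r → ZMod p),
      ∃ φ : (Fin n → ZMod p) →ₗ[ZMod p] (Fin r → ZMod p), f = φ := by
    rintro _ ⟨h, rfl⟩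
    exact ⟨h.toZModLinearMap p, rfl⟩
  have hfar : ∀ f : (Fin n → ZMod p) → (Fin r → ZMod p),
      IsFar ε f (homProperty (Fin n → ZMod p) (Fin r → ZMod p)) → ∃ ρ : ℝ, 0 < ρ ∧
      ((additivityViolations f).card : ℝ) = ρ * (Fintype.card (Fin n → ZMod p) : ℝ) ^ 2 ∧
      4 / (ρ * (Fintype.card (ZMod p) : ℝ) ^ k) + Real.exp (-(ρ * m / 6)) ≤ 1 / 8 := by
    intro f hf
    have hV := violations_ge_of_isFar hε1 hf
    have hg : (0 : ℝ) < (Fintype.card (Fin n → ZMod p) : ℝ) ^ 2 := by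
      have : (0 : ℝ) < Fintype.card (Fin n → ZMod p) := by exact_mod_cast Fintype.card_pos
      positivity
    have hρ : ε / 6 ≤ (additivityViolations f).card / (Fintype.card (Fin n → ZMod p) : ℝ) ^ 2 := by
      rwa [le_div_iff₀ hg]
    refine ⟨_, lt_of_lt_of_le (by positivity) hρ, (div_mul_cancel₀ _ hg.ne').symm,
      no_failed_check_bound hε0 hε1 hρ ?_⟩
    rw [ZMod.card]
    have h2p : (2 : ℝ) ≤ p := by exact_mod_cast hp2
    calc (2 : ℝ) ^ m ≤ 2 ^ k := pow_le_pow_right₀ (by norm_num) (by lia)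
      _ ≤ (p : ℝ) ^ k := pow_le_pow_left₀ (by norm_num) h2p k
  refine ⟨homTester (ZMod p) _ _ k m, ⟨_, ?_, homTester_queriesAtMost⟩,
    homTester_isOnlineTester (t := t) hP (fun f A hA => hA.1) (by rwa [ZMod.card])
      (by rwa [hcardG]) hfar,
    homTester_hasOneSidedError t hP,
    homTester_isOnlineTester (t := t) hP (fun f A hA => hA.1) (by rwa [ZMod.card])
      (by rwa [hcardG]) hfar⟩
  obtain ⟨hlog0, hlog⟩ := clog_le_logb_add_one (p := p) (by lia) t
  have hq : 2 * (k + 1) + m ≤ 4 * (L + m) := by lia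
  have hq' : ((2 * (k + 1) + m : ℕ) : ℝ) ≤ 4 * (L + m) := by exact_mod_cast hq
  have hmε : (m : ℝ) ≤ 109 * (1 / ε) := by
    rw [mul_one_div, le_div_iff₀ hε0]
    linarith
  have hε : 1 ≤ 1 / ε := by
    rw [le_div_iff₀ hε0]
    linarith
  linarith
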